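/- Rings are unital and not necessarily commutative. A ring $A$ is \emph{stably finite} if for every $k\ge 1$ and all $x,y\in \mathrm{Mat}_k(A)$, $xy=1$ implies $yx=1$. For a finite symmetric generating set $B$ of a group $\Gamma$ (that is, $B=B^{-1}$), the Cayley graph of $(\Gamma,B)$ is the $B$-labeled digraph with vertex set $\Gamma$ and an edge $(g,gb)$, labeled $b$, for all $g\in \Gamma$ and $b\in B$. The $r$-neighborhood of a vertex $v$ of a labeled digraph is the induced labeled digraph on the vertices that are reached from $v$ by a directed path with at most $r$ edges. A finitely generated group $\Gamma$ is \emph{sofic} if for every finite symmetric generating set $B$ of $\Gamma$, every $\varepsilon\in(0,1)$ and every $r\in\mathbb N$ there are a finite non-empty $B$-labeled digraph with vertex set $V$ (having at most one edge, with one label in $B$, for each ordered pair of vertices) and a subset $V_0\subseteq V$ with $|V_0|\ge(1-\varepsilon)|V|$ such that the $r$-neighborhood of each $v\in V_0$ is isomorphic, as a $B$-labeled digraph, to the $r$-neighborhood of $1$ in the Cayley graph of $(\Gamma,B)$. An arbitrary group is \emph{sofic} if all its finitely generated subgroups are. Let $R$ be a ring, $G$ a sofic group and $N$ a Noetherian left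 $R$-module. Then the endomorphism ring $\mathrm{End}_{R[G]}(R[G]\otimes_R N)$ of the left $R[G]$-module $R[G]\otimes_R N$ is stably finite. In particular, if $R$ is left Noetherian, then $R[G]$ is isomorphic to the ring of endomorphisms of the left $R[G]$-module $R[G]\otimes_R R$ acting on the right (that is, to the opposite of the ring of endomorphisms with composition $(\varphi\psi)(x)=\varphi(\psi(x))$), and $R[G]$ is stably finite. -/

import Mathlib

/-- A labeled directed graph with vertex set `V` and labels in `B`: a set of ordered pairs of
vertices (the edges), together with a map from the set of edges to `B`. -/
structure LabeledDigraph (V B : Type*) extends Digraph V where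
  /-- The label of an edge. -/
  label : ∀ {v w : V}, Adj v w → B

namespace LabeledDigraph

/-- An isomorphism of `B`-labeled digraphs: a bijection of the vertices that preserves and reflects
edges and preserves their labels. -/
structure Iso {V₁ V₂ B : Type*} (Γ₁ : LabeledDigraph V₁ B) (Γ₂ : LabeledDigraph V₂ B) where
  /-- The underlying bijection of the vertex sets. -/
  toEquiv : V₁ ≃ V₂
  adj_iff : ∀ v w, Γ₁.Adj v w ↔ Γ₂.Adj (toEquiv v) (toEquiv w)
  label_eq : ∀ v w (h : Γ₁.Adj v w), Γ₂.label ((adj_iff v w).1 h) = Γ₁.label h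

/-- The labeled digraph induced on a set of vertices. -/
def induce {V B : Type*} (Γ : LabeledDigraph V B) (s : Set V) : LabeledDigraph s B where
  Adj v w := Γ.Adj v w
  label h := Γ.label h

/-- `Γ.HasPath n v w`: there is a directed path with `n` edges from `v` to `w`. -/
inductive HasPath {V B : Type*} (Γ : LabeledDigraph V B) : ℕ → V → V → Prop
  | nil (v : V) : HasPath Γ 0 v v
  | cons {n : ℕ} {u v w : V} : Γ.Adj u v → HasPath Γ n v w → HasPath Γ (n + 1) u w

/-- The directed distance: the number of edges of a shortest directed path from `v` to `w`, and `⊤`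
if there is none. -/
noncomputable def dist {V B : Type*} (Γ : LabeledDigraph V B) (v w : V) : ℕ∞ :=
  ⨅ (n : ℕ) (_ : Γ.HasPath n v w), (n : ℕ∞)

/-- The `n`-th neighborhood of a vertex `v`. -/
def neighborhood {V B : Type*} (Γ : LabeledDigraph V B) (n : ℕ) (v : V) : Set V :=
  {w | Γ.dist v w ≤ n}

/-- The Cayley graph of a group `G` with respect to `B ⊆ G`: its edges are the pairs `(g, g * b)`
with `b ∈ B`, and such an edge has the label `b`. -/
def cayley {G : Type*} [Group G] (B : Set G) : LabeledDigraph G B where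
  Adj g h := g⁻¹ * h ∈ B
  label {g h} hgh := ⟨g⁻¹ * h, hgh⟩

end LabeledDigraph

/-- Soficity of a finitely generated group `G`: for each finite symmetric generating set `B`, each
`ε ∈ (0, 1)` and each `r : ℕ`, there is a finite non-empty `B`-labeled digraph in which all but a
proportion at most `ε` of the vertices have an `r`-neighborhood isomorphic, as a `B`-labeled
digraph, to the `r`-neighborhood of `1` in the Cayley graph. -/
def IsSoficFG (G : Type*) [Group G] : Prop :=
  ∀ B : Set G, B.Finite → (∀ b ∈ B, b⁻¹ ∈ B) → Subgroup.closure B = ⊤ →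
    ∀ ε : ℝ, 0 < ε → ε < 1 → ∀ r : ℕ,
      ∃ (V : Type) (_ : Fintype V) (_ : Nonempty V) (Γ : LabeledDigraph V B) (V₀ : Finset V),
        (1 - ε) * (Fintype.card V : ℝ) ≤ (V₀.card : ℝ) ∧
        ∀ v ∈ V₀, Nonempty
          ((Γ.induce (Γ.neighborhood r v)).Iso
            ((LabeledDigraph.cayley B).induce ((LabeledDigraph.cayley B).neighborhood r 1)))

/-- A group is sofic if each of its finitely generated subgroups is sofic. -/
def IsSofic (G : Type*) [Group G] : Prop :=
  ∀ H : Subgroup G, H.FG → IsSoficFG H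

open scoped TensorProduct in
/-- For a homomorphism `f : R → S` of (not necessarily commutative) rings and a left `R`-module `N`,
the left `S`-module `S ⊗_R N`, where `S` is a right `R`-module through `f`: the quotient of
`S ⊗_ℤ N` by the relations `(s * f r) ⊗ n = s ⊗ (r • n)`. (The additive subgroup that these
relations generate is stable under `S`, hence it is their `S`-span.) -/
abbrev TensorAlong {R S : Type*} [Ring R] [Ring S] (f : R →+* S)
    (N : Type*) [AddCommGroup N] [Module R N] : Type _ :=
  (S ⊗[ℤ] N) ⧸ Submodule.span S
    {t : S ⊗[ℤ] N | ∃ (s : S) (r : R) (n : N), t = (s * f r) ⊗ₜ[ℤ] n - s ⊗ₜ[ℤ] (r • n)}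

/-- The left `R[G]`-module `R[G] ⊗_R N`. -/
abbrev InducedModule (R G : Type*) [Ring R] [Group G]
    (N : Type*) [AddCommGroup N] [Module R N] : Type _ :=
  TensorAlong (MonoidAlgebra.singleOneRingHom : R →+* MonoidAlgebra R G) N

/-!
Why the theorem is true. Let `S = End_R(N)`. The ring `End_{R[G]}(R[G] ⊗_R N)` is isomorphic to the
group ring `S[G]` (`InducedModule.endRingHom_bijective`), and the matrices over `S[G]` form the group
ring of `End_R(N^k)`, where `N^k` is again Noetherian. So it suffices that `S[G]` is directly finite
whenever a ring `S` acts faithfully on a Noetherian `R`-module `N` by endomorphisms. Let `x * y = 1`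
in `S[G]` and let `e = 1 - y * x`, an idempotent with `x * e = 0`. Only the finitely generated
subgroup of `G` that the supports of `x` and `y` generate matters.

If `N` had finite length, one would copy `x`, `y` and `e` to operators on `V → N`, where `V` is the
vertex set of a finite labeled digraph that looks like the Cayley graph around most vertices. The
operator of `x` is almost onto, as `x * y = 1`, so its kernel has a length that is a small proportion
of `|V|`. But if `e ≠ 0`, the kernel contains the range of the operator of `e`, whose length is at
least a fixed proportion of `|V|`, as many vertices have disjoint neighborhoods
(`LabeledDigraph.card_mul_relLength_le`).

For a Noetherian `N` the length is replaced with the length relative to an injective module `E`,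
that is, the length of `Hom_R(-, E)` over `End_R(E)`. It is additive because `E` is injective. Some
`E` has to be found such that `N` has finite length relative to `E`, while the nonzero
ranges of coefficients of `e` have positive length. First pass to a subquotient of `N` on which `e`
still acts nontrivially and which has no proper nonzero `S`-stable submodule
(`IsSoficFG.action_coeff_one_sub_mul_eq_zero`); this works because `N` is Noetherian and `e` is
idempotent. Then every nonzero submodule `M` of `N` generates `N` under `S`, hence `N` is a quotient
of a finite power of `M`. Choose `M` monoform, that is, such that nonzero maps from submodules of
`M` to `M` are injective, and let `E` be its injective hull: all nonzero maps `M → E` are injective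
and extend each other, so that `M` has length one and `N` has finite length
(`exists_relLength_ne_top`).
-/

/-! ### Injective hulls -/

/-- Every module embeds into an injective module. -/
theorem exists_baer_embedding.{u, v} {R : Type u} [Ring R] (M : Type v) [AddCommGroup M]
    [Module R M] :
    ∃ (Q : Type (max u v)) (_ : AddCommGroup Q) (_ : Module R Q) (j : M →ₗ[R] Q),
      Module.Baer R Q ∧ Function.Injective j := by
  have := ModuleCat.enoughInjectives.{v} R
  obtain ⟨⟨Q, hQ, f, hf⟩⟩ := CategoryTheory.EnoughInjectives.presentation
    (ModuleCat.of.{max u v} R (ULift.{u} M))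
  have : Module.Injective R Q := Module.injective_module_of_injective_object R Q
  refine ⟨Q, inferInstance, inferInstance, f.hom ∘ₗ ULift.moduleEquiv.symm.toLinearMap,
    Module.Baer.of_injective this, ?_⟩
  have hf' : Function.Injective f.hom := (ModuleCat.mono_iff_injective f).1 hf
  simpa using hf'

/-- Every module embeds into an injective module `E` that is essential over its image: `E` is an
injective hull. It is found inside an injective module `Q` that contains `M`, as a maximal essential
extension `K` of `M` in `Q`: if `Z` is maximal among the submodules disjoint from `K`, then `K → Q`
extends along `K → Q ⧸ Z` to an injective map with an essential image, so that `K` is a retract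
of `Q`. -/
theorem exists_injective_hull.{u, v} {R : Type u} [Ring R] (M : Type v) [AddCommGroup M]
    [Module R M] :
    ∃ (E : Type (max u v)) (_ : AddCommGroup E) (_ : Module R E) (i : M →ₗ[R] E),
      Module.Baer R E ∧ Function.Injective i ∧
        ∀ L : Submodule R E, Disjoint L (LinearMap.range i) → L = ⊥ := by
  obtain ⟨Q, _, _, j, hQ, hj⟩ := exists_baer_embedding (R := R) M
  let M₀ := LinearMap.range j
  obtain ⟨K, hMK, hK⟩ := zorn_le_nonempty₀
    {K : Submodule R Q | M₀ ≤ K ∧ ∀ L ≤ K, Disjoint L M₀ → L = ⊥} (by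
      intro c hc hchain y hy
      refine ⟨sSup c, ⟨(hc hy).1.trans (le_sSup hy), fun L hL hd => ?_⟩, fun z hz => le_sSup hz⟩
      rw [Submodule.eq_bot_iff]
      intro x hx
      obtain ⟨z, hz, hxz⟩ := (Submodule.mem_sSup_of_directed ⟨y, hy⟩ hchain.directedOn).1 (hL hx)
      have := (hc hz).2 (L ⊓ z) inf_le_right (hd.mono_left inf_le_left)
      exact (Submodule.eq_bot_iff _).1 this x ⟨hx, hxz⟩) M₀
    ⟨le_rfl, fun L hL hd => hd.eq_bot_of_le hL⟩
  obtain ⟨Z, -, hZ⟩ := zorn_le_nonempty₀ {Z : Submodule R Q | Disjoint Z K} (by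
      intro c hc hchain y hy
      refine ⟨sSup c, ?_, fun z hz => le_sSup hz⟩
      refine Submodule.disjoint_def.2 fun x hx hxK => ?_
      obtain ⟨z, hz, hxz⟩ := (Submodule.mem_sSup_of_directed ⟨y, hy⟩ hchain.directedOn).1 hx
      exact Submodule.disjoint_def.1 (hc hz) x hxz hxK) ⊥ disjoint_bot_left
  have hZK : Disjoint Z K := hZ.prop
  obtain ⟨k, hk⟩ := hQ.extension_property (Z.mkQ ∘ₗ K.subtype)
    (by
      rw [← LinearMap.ker_eq_bot, LinearMap.ker_comp, Submodule.ker_mkQ, Submodule.eq_bot_iff]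
      intro x hx
      exact Subtype.ext (Submodule.disjoint_def.1 hZK x hx x.2)) K.subtype
  let u : Q →ₗ[R] Q := k ∘ₗ Z.mkQ
  have hu : ∀ x ∈ K, u x = x := fun x hx => LinearMap.congr_fun hk ⟨x, hx⟩
  have hZu : ∀ z ∈ Z, u z = 0 := fun z hz => by
    simp [u, (Submodule.Quotient.mk_eq_zero Z).2 hz]
  -- a submodule that contains `Z` and is disjoint from `K` is killed by `u`
  have key : ∀ W : Submodule R Q, Z ≤ W → Disjoint W K → ∀ w ∈ W, u w = 0 := fun W h1 h2 w hw =>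
    hZu w (hZ.le_of_ge h2 h1 hw)
  have hrange : LinearMap.range u ≤ K := by
    refine hK.le_of_ge ⟨?_, fun L hL hd => ?_⟩ ?_
    · exact fun x hx => ⟨x, hu x (hMK hx)⟩
    · have h1 : L ⊓ K = ⊥ := hK.prop.2 _ inf_le_right (hd.mono_left inf_le_left)
      have h2 := key (L.comap u) (fun z hz => by simp [hZu z hz])
        (Submodule.disjoint_def.2 fun x hx hxK => by
          rw [Submodule.mem_comap, hu x hxK] at hx
          exact (Submodule.eq_bot_iff _).1 h1 x ⟨hx, hxK⟩)
      rw [Submodule.eq_bot_iff]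
      intro x hx
      obtain ⟨y, rfl⟩ := hL hx
      exact h2 y hx
    · exact fun x hx => ⟨x, hu x hx⟩
  refine ⟨K, inferInstance, inferInstance, j.codRestrict K fun x => hMK ⟨x, rfl⟩, ?_, ?_, ?_⟩
  · intro I g
    obtain ⟨g', hg'⟩ := hQ I (K.subtype ∘ₗ g)
    refine ⟨u.codRestrict K (fun x => hrange ⟨x, rfl⟩) ∘ₗ g', fun x hx => Subtype.ext ?_⟩
    simp [hg' x hx, hu]
  · intro x y hxy
    exact hj (congrArg Subtype.val hxy)
  · intro L hL
    have := hK.prop.2 (L.map K.subtype) (Submodule.map_subtype_le _ _) (by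
      refine Submodule.disjoint_def.2 ?_
      rintro _ ⟨x, hx, rfl⟩ ⟨y, hy⟩
      have := Submodule.disjoint_def.1 hL x hx ⟨y, Subtype.ext hy⟩
      simp [this])
    exact Submodule.map_injective_of_injective K.injective_subtype
      (this.trans (Submodule.map_bot _).symm)

/-! ### The length of a module relative to an injective module -/

/-- The length of a module `X` relative to an injective module `E`: the length of `Hom_R(X, E)` over
the ring `End_R(E)`, which acts by composition. As `Hom_R(-, E)` is exact, it is additive. -/
noncomputable def Module.relLength (R E X : Type*) [Ring R] [AddCommGroup E] [Module R E]
    [AddCommGroup X] [Module R X] : ℕ∞ :=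
  Module.length (Module.End R E) (X →ₗ[R] E)

section relLength

variable {R E X Y : Type*} [Ring R] [AddCommGroup E] [Module R E] [AddCommGroup X] [Module R X]
  [AddCommGroup Y] [Module R Y]

/-- Composition with `f : X → Y`, as an `End_R(E)`-linear map `Hom_R(Y, E) → Hom_R(X, E)`. -/
def LinearMap.precompEnd (E : Type*) [AddCommGroup E] [Module R E] (f : X →ₗ[R] Y) :
    (Y →ₗ[R] E) →ₗ[Module.End R E] (X →ₗ[R] E) where
  toFun g := g ∘ₗ f
  map_add' _ _ := LinearMap.add_comp _ _ _
  map_smul' _ _ := rfl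

theorem Module.relLength_le_of_surjective (f : X →ₗ[R] Y) (hf : Function.Surjective f) :
    Module.relLength R E Y ≤ Module.relLength R E X :=
  Module.length_le_of_injective (f.precompEnd E) fun g h hgh =>
    LinearMap.ext fun y => by
      obtain ⟨x, rfl⟩ := hf y
      exact LinearMap.congr_fun hgh x

theorem Module.relLength_le_of_injective (hE : Module.Baer R E) (f : X →ₗ[R] Y)
    (hf : Function.Injective f) : Module.relLength R E X ≤ Module.relLength R E Y :=
  Module.length_le_of_surjective (f.precompEnd E) fun g => hE.extension_property f hf g

theorem Module.relLength_eq_ker_add_range (hE : Module.Baer R E) (f : X →ₗ[R] Y) :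
    Module.relLength R E X =
      Module.relLength R E (LinearMap.ker f) + Module.relLength R E (LinearMap.range f) := by
  rw [add_comm]
  refine Module.length_eq_add_of_exact (f.rangeRestrict.precompEnd E)
    ((LinearMap.ker f).subtype.precompEnd E) ?_ ?_ ?_
  · intro g h hgh
    ext ⟨_, x, rfl⟩
    exact LinearMap.congr_fun hgh x
  · exact fun g => hE.extension_property _ (LinearMap.ker f).injective_subtype g
  · intro g
    constructor
    · intro hg
      have hle : LinearMap.ker f.rangeRestrict ≤ LinearMap.ker g := by
        intro x hx
        rw [LinearMap.ker_rangeRestrict] at hx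
        exact LinearMap.congr_fun hg ⟨x, hx⟩
      refine ⟨(LinearMap.ker f.rangeRestrict).liftQ g hle ∘ₗ
        (f.rangeRestrict.quotKerEquivOfSurjective f.surjective_rangeRestrict).symm.toLinearMap, ?_⟩
      ext x
      have : (f.rangeRestrict.quotKerEquivOfSurjective f.surjective_rangeRestrict).symm
          (f.rangeRestrict x) = Submodule.Quotient.mk x := by
        rw [LinearEquiv.symm_apply_eq]; rfl
      change (LinearMap.ker f.rangeRestrict).liftQ g hle (LinearEquiv.symm _ (f.rangeRestrict x)) = _
      rw [this]
      rfl
    · rintro ⟨h, rfl⟩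
      ext ⟨x, hx⟩
      have : f.rangeRestrict x = 0 := Subtype.ext hx
      change h (f.rangeRestrict x) = 0
      rw [this, map_zero]

theorem Module.relLength_pi (ι : Type*) [Fintype ι] :
    Module.relLength R E (ι → X) = Fintype.card ι * Module.relLength R E X := by
  classical
  rw [Module.relLength, ← (LinearMap.lsum R (fun _ : ι => X) (Module.End R E)).length_eq]
  simp [Module.relLength]

theorem Module.one_le_relLength (f : X →ₗ[R] E) (hf : f ≠ 0) : 1 ≤ Module.relLength R E X := by
  have : Nontrivial (X →ₗ[R] E) := ⟨f, 0, hf⟩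
  exact Order.one_le_iff_pos.2 Module.length_pos

end relLength

/-! ### Noetherian modules that are simple under a commuting ring action -/

/-- A nonzero Noetherian module `N` has a nonzero submodule `M` that is monoform: a nonzero map from
a submodule of `M` to `M` is injective. If `g` is a nonzero map from a submodule of `N` to `N` with
a maximal kernel, then its range is such a submodule. -/
theorem exists_monoform_submodule (R N : Type*) [Ring R] [AddCommGroup N] [Module R N]
    [IsNoetherian R N] [Nontrivial N] :
    ∃ M : Submodule R N, M ≠ ⊥ ∧
      ∀ (D : Submodule R M) (h : D →ₗ[R] M), h ≠ 0 → Function.Injective h := by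
  let P : Set (Submodule R N) := {K | ∃ (D : Submodule R N) (g : D →ₗ[R] N), g ≠ 0 ∧
    (LinearMap.ker g).map D.subtype = K}
  have hP : P.Nonempty := by
    refine ⟨_, ⊤, (⊤ : Submodule R N).subtype, fun h => ?_, rfl⟩
    obtain ⟨x, hx⟩ := exists_ne (0 : N)
    exact hx (LinearMap.congr_fun h ⟨x, trivial⟩)
  obtain ⟨_, ⟨D, g, hg, rfl⟩, hmax⟩ := set_has_maximal_iff_noetherian.2 ‹IsNoetherian R N› P hP
  refine ⟨LinearMap.range g, fun h => hg (LinearMap.range_eq_bot.1 h), fun D₁ h hh => ?_⟩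
  -- the composite `g ⁻¹ D₁ → D₁ → N`, whose kernel contains that of `g`
  let D₂ : Submodule R D := D₁.comap g.rangeRestrict
  let g₂ : D₂ →ₗ[R] N := (LinearMap.range g).subtype ∘ₗ h ∘ₗ
    g.rangeRestrict.restrict (p := D₂) (q := D₁) fun _ hx => hx
  have hsurj : ∀ y : D₁, ∃ x : D₂,
      g.rangeRestrict.restrict (p := D₂) (q := D₁) (fun _ hx => hx) x = y := by
    rintro ⟨⟨_, x, rfl⟩, hx⟩
    exact ⟨⟨x, hx⟩, rfl⟩
  let e : D₂.map D.subtype ≃ₗ[R] D₂ :=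
    (Submodule.equivMapOfInjective D.subtype D.injective_subtype D₂).symm
  have he : ∀ x : D₂, (x : D).1 ∈ D₂.map D.subtype := fun x => ⟨x, x.2, rfl⟩
  have hee : ∀ x : D₂, e ⟨(x : D).1, he x⟩ = x := fun x => by
    rw [LinearEquiv.symm_apply_eq]; rfl
  have hne : g₂ ∘ₗ e.toLinearMap ≠ 0 := by
    intro h0
    refine hh (LinearMap.ext fun y => ?_)
    obtain ⟨x, rfl⟩ := hsurj y
    have := LinearMap.congr_fun h0 ⟨(x : D).1, he x⟩
    change g₂ (e _) = 0 at this
    rw [hee] at this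
    exact Subtype.ext this
  have hle : (LinearMap.ker g).map D.subtype ≤
      (LinearMap.ker (g₂ ∘ₗ e.toLinearMap)).map (D₂.map D.subtype).subtype := by
    rintro _ ⟨x, hx, rfl⟩
    have hx0 : g.rangeRestrict x = 0 := Subtype.ext hx
    have hxD : x ∈ D₂ := by simp [D₂, hx0]
    refine ⟨⟨x.1, he ⟨x, hxD⟩⟩, ?_, rfl⟩
    change g₂ (e _) = 0
    rw [hee ⟨x, hxD⟩]
    have : g.rangeRestrict.restrict (p := D₂) (q := D₁) (fun _ hx => hx) ⟨x, hxD⟩ = 0 :=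
      Subtype.ext hx0
    simp [g₂, this]
  have heq := eq_of_le_of_not_lt hle (hmax _ ⟨_, _, hne, rfl⟩)
  rw [← LinearMap.ker_eq_bot, Submodule.eq_bot_iff]
  intro y hy
  obtain ⟨x, rfl⟩ := hsurj y
  have hmem : (x : D).1 ∈
      (LinearMap.ker (g₂ ∘ₗ e.toLinearMap)).map (D₂.map D.subtype).subtype := by
    refine ⟨⟨(x : D).1, he x⟩, ?_, rfl⟩
    change g₂ (e _) = 0
    rw [hee]
    change ((h _ : LinearMap.range g) : N) = 0
    rw [LinearMap.mem_ker.1 hy]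
    rfl
  rw [← heq] at hmem
  obtain ⟨x', hx', hxx⟩ := hmem
  have : x' = x := Subtype.ext hxx
  subst this
  exact Subtype.ext (Subtype.ext hx')

/-- If `M` is monoform and `E` is an injective hull of `M`, then all nonzero maps `M → E` are
injective, hence they extend each other: `Hom_R(M, E)` is simple over `End_R(E)`. -/
theorem relLength_eq_one_of_monoform {R M E : Type*} [Ring R] [AddCommGroup M] [Module R M]
    [Nontrivial M] [AddCommGroup E] [Module R E]
    (hM : ∀ (D : Submodule R M) (h : D →ₗ[R] M), h ≠ 0 → Function.Injective h)
    (hE : Module.Baer R E) (i : M →ₗ[R] E) (hi : Function.Injective i)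
    (hess : ∀ L : Submodule R E, Disjoint L (LinearMap.range i) → L = ⊥) :
    Module.relLength R E M = 1 := by
  rw [Module.relLength, Module.length_eq_one_iff, isSimpleModule_iff_toSpanSingleton_surjective]
  refine ⟨⟨i, 0, ?_⟩, fun f hf g => ?_⟩
  · rintro rfl
    obtain ⟨x, hx⟩ := exists_ne (0 : M)
    exact hx (hi (by simp))
  have hfi : Function.Injective f := by
    let D : Submodule R M := (LinearMap.range i).comap f
    let e := LinearEquiv.ofInjective i hi
    let h : D →ₗ[R] M := e.symm.toLinearMap ∘ₗ
      f.restrict (p := D) (q := LinearMap.range i) fun _ hx => hx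
    have hh : ∀ x : D, i (h x) = f x := fun x =>
      congrArg Subtype.val (e.apply_symm_apply ⟨f x, x.2⟩)
    have hne : h ≠ 0 := by
      intro h0
      refine hf (LinearMap.range_eq_bot.1 (hess _ (Submodule.disjoint_def.2 ?_)))
      rintro _ ⟨x, rfl⟩ hx
      rw [← hh ⟨x, hx⟩, h0, LinearMap.zero_apply, map_zero]
    rw [← LinearMap.ker_eq_bot, Submodule.eq_bot_iff]
    intro x hx
    have hxD : x ∈ D := by
      change f x ∈ LinearMap.range i
      rw [LinearMap.mem_ker.1 hx]
      exact zero_mem _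
    have : (⟨x, hxD⟩ : D) = 0 := hM D h hne (hi (by
      rw [hh, map_zero, map_zero]
      exact hx))
    exact congrArg Subtype.val this
  obtain ⟨k, hk⟩ := hE.extension_property f hfi g
  exact ⟨k, hk⟩

/-- Let a ring `S` act on a nonzero Noetherian module `N` through endomorphisms, such that no proper
nonzero submodule is stable under `S`. Then there is an injective module `E` relative to which `N`
has finite length and every nonzero submodule of `N` has positive length. Every nonzero submodule
`M` generates `N` under `S`, hence `N` is a quotient of a finite power of `M`; so `E` can be taken
to be the injective hull of a monoform submodule. -/
theorem exists_relLength_ne_top.{u, v, w} {R : Type u} {N : Type v} {S : Type w} [Ring R]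
    [AddCommGroup N] [Module R N] [Ring S] [IsNoetherian R N] [Nontrivial N] (ρ : S →+* Module.End R N)
    (hρ : ∀ K : Submodule R N, (∀ s, K ≤ K.comap (ρ s)) → K = ⊥ ∨ K = ⊤) :
    ∃ (E : Type (max u v)) (_ : AddCommGroup E) (_ : Module R E), Module.Baer R E ∧
      Module.relLength R E N ≠ ⊤ ∧
      ∀ K : Submodule R N, K ≠ ⊥ → 1 ≤ Module.relLength R E K := by
  classical
  have hgen : ∀ M : Submodule R N, M ≠ ⊥ → ⨆ s, M.map (ρ s) = ⊤ := by
    intro M hM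
    refine (hρ _ fun s => ?_).resolve_left fun h => hM ?_
    · refine iSup_le fun t => ?_
      rw [← Submodule.map_le_iff_le_comap, ← Submodule.map_comp]
      have : (ρ s) ∘ₗ (ρ t) = ρ (s * t) := (map_mul ρ s t).symm
      rw [this]
      exact le_iSup (fun s => M.map (ρ s)) (s * t)
    · rw [eq_bot_iff, ← h]
      refine le_iSup_of_le 1 ?_
      rw [map_one]
      exact (Submodule.map_id M).ge
  obtain ⟨M, hM0, hM⟩ := exists_monoform_submodule R N
  have : Nontrivial M := Submodule.nontrivial_iff_ne_bot.2 hM0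
  obtain ⟨E, _, _, i, hE, hi, hess⟩ := exists_injective_hull (R := R) M
  refine ⟨E, inferInstance, inferInstance, hE, ?_, fun K hK => ?_⟩
  · obtain ⟨t, ht⟩ := CompleteLattice.IsCompactElement.exists_finset_of_le_iSup (Submodule R N)
      ((Submodule.fg_iff_compact _).1 (IsNoetherian.noetherian (⊤ : Submodule R N)))
      (fun s => M.map (ρ s)) (hgen M hM0).ge
    let f : (t → M) →ₗ[R] N := LinearMap.lsum R (fun _ => M) ℕ fun s => ρ s ∘ₗ M.subtype
    have hf : Function.Surjective f := by
      rw [← LinearMap.range_eq_top, eq_top_iff]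
      refine ht.trans (iSup₂_le fun s hs => ?_)
      rintro _ ⟨x, hx, rfl⟩
      refine ⟨Pi.single ⟨s, hs⟩ ⟨x, hx⟩, ?_⟩
      simp only [f, LinearMap.lsum_piSingle]
      rfl
    refine ne_top_of_le_ne_top ?_ (Module.relLength_le_of_surjective f hf)
    rw [Module.relLength_pi, relLength_eq_one_of_monoform hM hE i hi hess]
    simp
  · obtain ⟨j, hj⟩ := hE.extension_property M.subtype M.injective_subtype i
    by_contra hlen
    have hzero : ∀ s, j ∘ₗ ρ s ∘ₗ K.subtype = 0 := fun s => by
      by_contra h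
      exact hlen (Module.one_le_relLength _ h)
    have hjtop : (⊤ : Submodule R N) ≤ LinearMap.ker j := by
      rw [← hgen K hK]
      refine iSup_le fun s => ?_
      rintro _ ⟨x, hx, rfl⟩
      exact LinearMap.congr_fun (hzero s) ⟨x, hx⟩
    obtain ⟨x, hx⟩ := exists_ne (0 : M)
    refine hx (hi ?_)
    rw [map_zero, ← LinearMap.congr_fun hj x]
    exact hjtop trivial

/-! ### Labeled digraphs that are locally Cayley graphs -/

namespace LabeledDigraph

/-- There is an edge from `v` to `w` with the label `b`. -/
def Edge {V B : Type*} (Γ : LabeledDigraph V B) (v : V) (b : B) (w : V) : Prop :=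
  ∃ h : Γ.Adj v w, Γ.label h = b

/-- `p` is a chart at `v`: paths of length at most two that start at `v` look as in the Cayley
graph. For each `b ∈ B` the outgoing edges of `p b` are exactly those that lead to `p (b * c)`, with
the label `c`, for `c ∈ B`. In the presence of `1 ∈ B` this includes the edges from `v` itself.
Nothing is required of the values of `p` outside `B * B`. -/
def IsChart {V H : Type*} [Group H] {B : Set H} (Γ : LabeledDigraph V B) (v : V) (p : H → V) :
    Prop :=
  p 1 = v ∧ ∀ b ∈ B, ∀ (c : B) (x : V), Γ.Edge (p b) c x ↔ x = p (b * c)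

theorem IsChart.injOn {V H : Type*} [Group H] {B : Set H} {Γ : LabeledDigraph V B} {v : V}
    {p : H → V} (hp : Γ.IsChart v p) (h1 : 1 ∈ B) : Set.InjOn p B := by
  intro b hb c hc h
  obtain ⟨e, he⟩ := (hp.2 1 h1 ⟨b, hb⟩ (p b)).2 (by simp)
  obtain ⟨e', he'⟩ := (hp.2 1 h1 ⟨c, hc⟩ (p b)).2 (by simpa using h)
  exact congrArg Subtype.val (he.symm.trans he')

theorem mem_neighborhood_two {V B : Type*} (Γ : LabeledDigraph V B) (v w : V) :
    w ∈ Γ.neighborhood 2 v ↔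
      w = v ∨ Γ.Adj v w ∨ ∃ u, Γ.Adj v u ∧ Γ.Adj u w := by
  have hdist : w ∈ Γ.neighborhood 2 v ↔ ∃ n ≤ 2, Γ.HasPath n v w := by
    change Γ.dist v w ≤ ((2 : ℕ) : ℕ∞) ↔ _
    constructor
    · intro h
      by_contra hn
      push Not at hn
      have : ((3 : ℕ) : ℕ∞) ≤ Γ.dist v w := by
        refine le_iInf₂ fun n hp => ?_
        have : ¬ n ≤ 2 := fun h2 => hn n h2 hp
        exact_mod_cast (by lia : 3 ≤ n)
      have := this.trans h
      norm_cast at this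
    · rintro ⟨n, hn, hp⟩
      exact (iInf₂_le n hp).trans (by exact_mod_cast hn)
  rw [hdist]
  constructor
  · rintro ⟨n, hn, hp⟩
    cases hp with
    | nil => exact Or.inl rfl
    | cons h1 hp =>
      cases hp with
      | nil => exact Or.inr (Or.inl h1)
      | cons h2 hp =>
        cases hp with
        | nil => exact Or.inr (Or.inr ⟨_, h1, h2⟩)
        | cons h3 hp => lia
  · rintro (rfl | h | ⟨u, h1, h2⟩)
    · exact ⟨0, by lia, .nil _⟩
    · exact ⟨1, by lia, .cons h (.nil _)⟩
    · exact ⟨2, by lia, .cons h1 (.cons h2 (.nil _))⟩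

open scoped Pointwise in
/-- The isomorphism of neighborhoods need not send `v` to `1`. If it sends `v` to `h`, then the
finite set `B * B` lies in `h • (B * B)`, so both are equal and a translation by `h` corrects
this. -/
theorem exists_isChart {V H : Type*} [Group H] {B : Set H} (hB : B.Finite) (h1 : 1 ∈ B)
    (Γ : LabeledDigraph V B) (v : V)
    (β : (Γ.induce (Γ.neighborhood 2 v)).Iso
      ((cayley B).induce ((cayley B).neighborhood 2 1))) :
    ∃ p : H → V, Γ.IsChart v p := by
  classical
  have hball : ∀ g : H, g ∈ (cayley B).neighborhood 2 1 ↔ g ∈ B * B := by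
    intro g
    rw [mem_neighborhood_two, Set.mem_mul]
    constructor
    · rintro (rfl | h | ⟨u, hu, h⟩)
      · exact ⟨1, h1, 1, h1, one_mul 1⟩
      · exact ⟨1, h1, g, by simpa [cayley] using h, one_mul g⟩
      · exact ⟨u, by simpa [cayley] using hu, u⁻¹ * g, h, mul_inv_cancel_left u g⟩
    · rintro ⟨b, hb, c, hc, rfl⟩
      exact Or.inr (Or.inr ⟨b, by simpa [cayley] using hb, by simpa [cayley] using hc⟩)
  have hv : v ∈ Γ.neighborhood 2 v := (Γ.mem_neighborhood_two v v).2 (Or.inl rfl)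
  let f : Γ.neighborhood 2 v → H := fun w => (β.toEquiv w).1
  -- edges between vertices of the neighborhood, in terms of `f`
  have hedge : ∀ (u w : Γ.neighborhood 2 v) (c : B), Γ.Edge u c w ↔ f w = f u * c := by
    intro u w c
    have hadj : Γ.Adj u w ↔ (f u)⁻¹ * f w ∈ B := β.adj_iff u w
    constructor
    · rintro ⟨h, hc⟩
      have hl := β.label_eq u w h
      have : (f u)⁻¹ * f w = c := congrArg Subtype.val (hl.trans hc)
      rw [← this, mul_inv_cancel_left]
    · intro h
      have h' : (f u)⁻¹ * f w = c := by rw [h, inv_mul_cancel_left]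
      have hA : Γ.Adj u w := hadj.2 (h' ▸ c.2)
      refine ⟨hA, ?_⟩
      have hl := β.label_eq u w hA
      exact hl.symm.trans (Subtype.ext h')
  have hadj : ∀ u w : Γ.neighborhood 2 v, Γ.Adj u w → ∃ c ∈ B, f w = f u * c := fun u w h =>
    ⟨Γ.label h, (Γ.label h).2, (hedge u w _).1 ⟨h, rfl⟩⟩
  let h₀ : H := f ⟨v, hv⟩
  have hsub : B * B ⊆ h₀ • (B * B) := by
    intro g hg
    obtain ⟨w, hw⟩ : ∃ w, f w = g :=
      ⟨β.toEquiv.symm ⟨g, (hball g).2 hg⟩, congrArg Subtype.val (β.toEquiv.apply_symm_apply _)⟩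
    rw [Set.mem_smul_set]
    have := (Γ.mem_neighborhood_two v w).1 w.2
    obtain h | h | ⟨u, hu, h⟩ := this
    · have : w = ⟨v, hv⟩ := Subtype.ext h
      refine ⟨1, ⟨1, h1, 1, h1, one_mul 1⟩, ?_⟩
      rw [smul_eq_mul, mul_one, ← hw, this]
    · obtain ⟨c, hc, hcw⟩ := hadj ⟨v, hv⟩ w h
      exact ⟨c, ⟨1, h1, c, hc, one_mul c⟩, by rw [smul_eq_mul, ← hw, hcw]⟩
    · have hu' : u ∈ Γ.neighborhood 2 v := (Γ.mem_neighborhood_two v u).2 (Or.inr (Or.inl hu))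
      obtain ⟨b, hb, hbu⟩ := hadj ⟨v, hv⟩ ⟨u, hu'⟩ hu
      obtain ⟨c, hc, hcw⟩ := hadj ⟨u, hu'⟩ w h
      exact ⟨b * c, ⟨b, hb, c, hc, rfl⟩, by rw [smul_eq_mul, ← hw, hcw, hbu, mul_assoc]⟩
  have heq : B * B = h₀ • (B * B) :=
    Set.eq_of_subset_of_ncard_le hsub (Set.ncard_smul_set h₀ (B * B)).le
      ((hB.mul hB).image _)
  have hmem : ∀ g ∈ B * B, h₀ * g ∈ (cayley B).neighborhood 2 1 := by
    intro g hg
    rw [hball, heq]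
    exact Set.smul_mem_smul_set hg
  let q : ∀ g ∈ B * B, Γ.neighborhood 2 v := fun g hg => β.toEquiv.symm ⟨h₀ * g, hmem g hg⟩
  have hq : ∀ g hg, f (q g hg) = h₀ * g := fun g hg =>
    congrArg Subtype.val (β.toEquiv.apply_symm_apply _)
  have hinj : Function.Injective f := Subtype.val_injective.comp β.toEquiv.injective
  have hBB : ∀ b ∈ B, b ∈ B * B := fun b hb => ⟨b, hb, 1, h1, mul_one b⟩
  have hq1 : q 1 (hBB 1 h1) = ⟨v, hv⟩ := hinj (by rw [hq _ (hBB 1 h1), mul_one])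
  refine ⟨fun g => if hg : g ∈ B * B then q g hg else v, ?_, fun b hb c x => ?_⟩
  · simp only [dif_pos (hBB 1 h1), hq1]
  · have hbc : b * c ∈ B * B := ⟨b, hb, c, c.2, rfl⟩
    simp only [dif_pos (hBB b hb), dif_pos hbc]
    have hvb : Γ.Adj v (q b (hBB b hb)) :=
      ((hedge ⟨v, hv⟩ (q b (hBB b hb)) ⟨b, hb⟩).2 (hq b (hBB b hb))).1
    constructor
    · intro hx
      have hx2 : x ∈ Γ.neighborhood 2 v :=
        (Γ.mem_neighborhood_two v x).2 (Or.inr (Or.inr ⟨_, hvb, hx.1⟩))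
      have := (hedge (q b (hBB b hb)) ⟨x, hx2⟩ c).1 hx
      have h2 : (⟨x, hx2⟩ : Γ.neighborhood 2 v) = q (b * c) hbc :=
        hinj (by rw [this, hq b (hBB b hb), hq (b * c) hbc, mul_assoc])
      exact congrArg Subtype.val h2
    · rintro rfl
      exact (hedge (q b (hBB b hb)) (q (b * c) hbc) c).2 (by
        rw [hq b (hBB b hb), hq (b * c) hbc, mul_assoc])

end LabeledDigraph

/-- The part of soficity that the argument uses: for a suitable `B`, all but a small proportion of
the vertices have a chart. -/
theorem IsSoficFG.exists_isChart {H : Type*} [Group H] (hH : IsSoficFG H) {B : Set H}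
    (hB : B.Finite) (h1 : 1 ∈ B) (hinv : ∀ b ∈ B, b⁻¹ ∈ B) (hgen : Subgroup.closure B = ⊤)
    {ε : ℝ} (hε : 0 < ε) (hε1 : ε < 1) :
    ∃ (V : Type) (_ : Fintype V) (_ : Nonempty V) (Γ : LabeledDigraph V B) (V₀ : Finset V),
      (1 - ε) * (Fintype.card V : ℝ) ≤ V₀.card ∧
        ∀ v ∈ V₀, ∃ p : H → V, Γ.IsChart v p := by
  obtain ⟨V, i1, i2, Γ, V₀, hcard, hV⟩ := hH B hB hinv hgen ε hε hε1 2
  exact ⟨V, i1, i2, Γ, V₀, hcard, fun v hv =>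
    (hV v hv).elim fun β => LabeledDigraph.exists_isChart hB h1 Γ v β⟩

/-- Among the vertices that have charts there are at least `|V₀| / |B|²` many whose neighborhoods
`p v '' B` are pairwise disjoint: if `p u '' B` meets `p v '' B`, then `u` lies in
`p v '' (B * B)`, as `B` is symmetric. -/
theorem LabeledDigraph.exists_disjoint_charts {V H : Type*} [Group H] {B : Set H}
    (hB : B.Finite) (h1 : 1 ∈ B) (hinv : ∀ b ∈ B, b⁻¹ ∈ B) (Γ : LabeledDigraph V B)
    (V₀ : Finset V) (p : V → H → V) (hp : ∀ v ∈ V₀, Γ.IsChart v (p v)) :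
    ∃ V₁ ⊆ V₀, V₀.card ≤ V₁.card * B.ncard ^ 2 ∧
      ∀ u ∈ V₁, ∀ v ∈ V₁, ∀ b ∈ B, ∀ c ∈ B, p u b = p v c → u = v := by
  classical
  obtain ⟨V₁, hV₁⟩ := (V₀.powerset.filter fun W => ∀ u ∈ W, ∀ v ∈ W, ∀ b ∈ B, ∀ c ∈ B,
    p u b = p v c → u = v).exists_maximal ⟨∅, by simp⟩
  have hV₁' := hV₁.prop
  simp only [Finset.mem_filter, Finset.mem_powerset] at hV₁'
  obtain ⟨hsub, hdisj⟩ := hV₁'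
  refine ⟨V₁, hsub, ?_, hdisj⟩
  have hmeet : ∀ u ∈ V₀, ∀ v ∈ V₀, ∀ b ∈ B, ∀ c ∈ B, p u b = p v c → u = p v (c * b⁻¹) := by
    intro u hu v hv b hb c hc h
    rw [← (hp v hv).2 c hc ⟨b⁻¹, hinv b hb⟩ u, ← h, (hp u hu).2 b hb ⟨b⁻¹, hinv b hb⟩ u]
    simp [(hp u hu).1]
  let F := hB.toFinset
  have hcover : V₀ ⊆ (V₁ ×ˢ F ×ˢ F).image fun t => p t.1 (t.2.1 * t.2.2) := by
    intro u hu
    suffices h : ∃ v ∈ V₁, ∃ b ∈ B, ∃ c ∈ B, p u b = p v c by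
      obtain ⟨v, hv, b, hb, c, hc, h⟩ := h
      refine Finset.mem_image.2 ⟨(v, c, b⁻¹), ?_, (hmeet u hu v (hsub hv) b hb c hc h).symm⟩
      simp [F, hv, hc, hinv b hb]
    by_cases huV : u ∈ V₁
    · exact ⟨u, huV, 1, h1, 1, h1, rfl⟩
    · by_contra hno
      push Not at hno
      refine huV (hV₁.le_of_ge (y := insert u V₁) ?_ (Finset.subset_insert u V₁)
        (Finset.mem_insert_self u V₁))
      simp only [Finset.mem_filter, Finset.mem_powerset, Finset.insert_subset_iff]
      refine ⟨⟨hu, hsub⟩, fun x hx y hy b hb c hc h => ?_⟩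
      rcases Finset.mem_insert.1 hx with rfl | hx' <;> rcases Finset.mem_insert.1 hy with rfl | hy'
      · rfl
      · exact absurd h (hno y hy' b hb c hc)
      · exact absurd h.symm (hno x hx' c hc b hb)
      · exact hdisj x hx' y hy' b hb c hc h
  refine (Finset.card_le_card hcover).trans (Finset.card_image_le.trans ?_)
  rw [Finset.card_product, Finset.card_product, Set.ncard_eq_toFinset_card B hB, sq]

/-! ### Convolution operators on the group and on a labeled digraph -/

section operators

variable {R N S H : Type*} [Ring R] [AddCommGroup N] [Module R N] [Ring S] [Group H]

/-- The action of the group ring `S[H]` on the functions `H → N`, where `S` acts on `N` through `ρ`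
and `H` acts by right translations: `(x • n) k = ∑ h, x h • n (k * h)`. -/
noncomputable def convolution (ρ : S →+* Module.End R N) :
    MonoidAlgebra S H →+* Module.End R (H → N) :=
  MonoidAlgebra.liftNCRingHom
    { toFun := fun s => LinearMap.pi fun k => ρ s ∘ₗ LinearMap.proj k
      map_one' := by ext; simp
      map_mul' := fun s t => by ext; simp
      map_zero' := by ext; simp
      map_add' := fun s t => by ext; simp }
    { toFun := fun h => LinearMap.funLeft R N fun k => k * h
      map_one' := by ext; simp [LinearMap.funLeft]
      map_mul' := fun g h => LinearMap.ext fun n => funext fun k => by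
        simp [LinearMap.funLeft, mul_assoc] }
    fun s h => LinearMap.ext fun n => rfl

theorem convolution_apply (ρ : S →+* Module.End R N) (x : MonoidAlgebra S H) (n : H → N) (k : H)
    (F : Finset H) (hF : x.coeff.support ⊆ F) :
    convolution ρ x n k = ∑ h ∈ F, ρ (x.coeff h) (n (k * h)) := by
  have key : convolution ρ x n k = x.coeff.sum fun h s => ρ s (n (k * h)) := by
    clear hF
    induction x using MonoidAlgebra.induction_linear with
    | zero => simp
    | add x y hx hy =>
      rw [map_add, LinearMap.add_apply, Pi.add_apply, hx, hy, MonoidAlgebra.coeff_add,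
        Finsupp.sum_add_index' (by simp) (by simp)]
    | single h s => simp [convolution, LinearMap.funLeft]
  rw [key, Finsupp.sum_of_support_subset _ hF _ (by simp)]

open Classical in
/-- The operator on the functions `V → N` on the vertices of a labeled digraph that copies the
convolution by `x`: the translation by `b` is replaced with the edges that have the label `b`. -/
noncomputable def LabeledDigraph.convolution {V : Type*} [Fintype V] {B : Set H} [Fintype B]
    (Γ : LabeledDigraph V B) (ρ : S →+* Module.End R N) (x : MonoidAlgebra S H) :
    Module.End R (V → N) :=
  LinearMap.pi fun v => ∑ c : B, ∑ w : V,
    if Γ.Edge v c w then ρ (x.coeff c) ∘ₗ LinearMap.proj w else 0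

variable {V : Type*} [Fintype V] {B : Set H} [Fintype B]

/-- In a chart, the operator on the digraph is the convolution on the group. -/
theorem LabeledDigraph.IsChart.convolution_apply {Γ : LabeledDigraph V B} {v : V} {p : H → V}
    (hp : Γ.IsChart v p) (ρ : S →+* Module.End R N) (x : MonoidAlgebra S H)
    (hx : ∀ h, x.coeff h ≠ 0 → h ∈ B) (n : V → N) {b : H} (hb : b ∈ B) :
    Γ.convolution ρ x n (p b) = _root_.convolution ρ x (n ∘ p) b := by
  classical
  rw [_root_.convolution_apply ρ x _ b B.toFinset
    fun h hh => by simpa using hx h (by simpa using hh)]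
  simp only [LabeledDigraph.convolution, LinearMap.pi_apply, LinearMap.sum_apply, hp.2 b hb]
  rw [← Finset.sum_set_coe B]
  refine Finset.sum_congr rfl fun c _ => ?_
  rw [Finset.sum_eq_single (p (b * c)) (fun w _ hw => by rw [if_neg hw, LinearMap.zero_apply])
    (by simp)]
  simp

/-- Products are respected at the vertices that have a chart. -/
theorem LabeledDigraph.IsChart.convolution_convolution_apply {Γ : LabeledDigraph V B} {v : V}
    {p : H → V} (hp : Γ.IsChart v p) (h1 : 1 ∈ B) (ρ : S →+* Module.End R N)
    (x y : MonoidAlgebra S H) (hx : ∀ h, x.coeff h ≠ 0 → h ∈ B) (hy : ∀ h, y.coeff h ≠ 0 → h ∈ B)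
    (n : V → N) :
    Γ.convolution ρ x (Γ.convolution ρ y n) v = _root_.convolution ρ (x * y) (n ∘ p) 1 := by
  classical
  have hxB : x.coeff.support ⊆ B.toFinset := fun h hh => by simpa using hx h (by simpa using hh)
  conv_lhs => rw [← hp.1]
  rw [hp.convolution_apply ρ x hx _ h1, map_mul, Module.End.mul_apply,
    _root_.convolution_apply ρ x _ 1 _ hxB, _root_.convolution_apply ρ x _ 1 _ hxB]
  refine Finset.sum_congr rfl fun h hh => ?_
  rw [one_mul, Function.comp_apply, hp.convolution_apply ρ y hy n (by simpa using hh)]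

end operators

/-! ### Direct finiteness of group rings that act on Noetherian modules -/

section core

variable {R N S H : Type*} [Ring R] [AddCommGroup N] [Module R N] [Ring S] [Group H]

/-- The length inequality on a labeled digraph. The operator of `x`, restricted to the vertices of
`V₀` as target, is onto because `x * y = 1`. As `x * e = 0`, its kernel contains the range of the
operator of `e`, which maps onto a product of copies, indexed by `V₁`, of the range of a
coefficient of `e`. -/
theorem LabeledDigraph.card_mul_relLength_le {E : Type*} [AddCommGroup E] [Module R E]
    (hE : Module.Baer R E) (ρ : S →+* Module.End R N) {V : Type*} [Fintype V] {B : Set H}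
    [Fintype B] (h1 : 1 ∈ B) (Γ : LabeledDigraph V B) (x y e : MonoidAlgebra S H)
    (hxB : ∀ h, x.coeff h ≠ 0 → h ∈ B) (hyB : ∀ h, y.coeff h ≠ 0 → h ∈ B)
    (heB : ∀ h, e.coeff h ≠ 0 → h ∈ B) (hxy : x * y = 1) (hxe : x * e = 0)
    (V₀ V₁ : Finset V) (hV : V₁ ⊆ V₀) (p : V → H → V) (hp : ∀ v ∈ V₀, Γ.IsChart v (p v))
    (hdisj : ∀ u ∈ V₁, ∀ v ∈ V₁, ∀ b ∈ B, ∀ c ∈ B, p u b = p v c → u = v) {g : H} (hg : g ∈ B) :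
    V₁.card * Module.relLength R E (LinearMap.range (ρ (e.coeff g))) +
      V₀.card * Module.relLength R E N ≤ Fintype.card V * Module.relLength R E N := by
  classical
  let A : (V → N) →ₗ[R] (V₀ → N) :=
    LinearMap.funLeft R N (Subtype.val : V₀ → V) ∘ₗ Γ.convolution ρ x
  have hA : ∀ n (v : V₀), A n v = Γ.convolution ρ x n v := fun n v => rfl
  have hsurj : Function.Surjective A := by
    intro n
    let n' : V → N := fun v => if h : v ∈ V₀ then n ⟨v, h⟩ else 0
    refine ⟨Γ.convolution ρ y n', funext fun v => ?_⟩
    rw [hA, (hp v v.2).convolution_convolution_apply h1 ρ x y hxB hyB, hxy, map_one,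
      Module.End.one_apply, Function.comp_apply, (hp v v.2).1]
    simp [n']
  let K := LinearMap.range (ρ (e.coeff g))
  -- the input with the value `n u` at the vertex `p u g`, for `u ∈ V₁`
  let ι : (V₁ → N) → V → N := fun n w => ∑ u : V₁, if p u g = w then n u else 0
  have hι : ∀ n (u : V₁), ∀ h ∈ B, ι n (p u h) = if h = g then n u else 0 := by
    intro n u h hh
    simp only [ι]
    rw [Finset.sum_eq_single u]
    · have : p u g = p u h ↔ h = g :=
        ⟨fun heq => ((hp u (hV u.2)).injOn h1 hg hh heq).symm, fun heq => by rw [heq]⟩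
      simp only [this]
    · intro w _ hw
      exact if_neg fun heq => hw (Subtype.ext (hdisj w w.2 u u.2 g hg h hh heq))
    · simp
  have heval : ∀ n (u : V₁), Γ.convolution ρ e (ι n) u = ρ (e.coeff g) (n u) := by
    intro n u
    have hu := hp u (hV u.2)
    conv_lhs => rw [← hu.1]
    rw [hu.convolution_apply ρ e heB _ h1, _root_.convolution_apply ρ e _ 1 B.toFinset
      fun h hh => by simpa using heB h (by simpa using hh), Finset.sum_eq_single g]
    · rw [one_mul, Function.comp_apply, hι n u g hg, if_pos rfl]
    · intro h hh hne
      rw [one_mul, Function.comp_apply, hι n u h (by simpa using hh), if_neg hne, map_zero]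
    · exact fun h => absurd (by simpa using hg) h
  let r : LinearMap.ker A →ₗ[R] (V₁ → N) :=
    LinearMap.funLeft R N (Subtype.val : V₁ → V) ∘ₗ (LinearMap.ker A).subtype
  have hmem : ∀ k : V₁ → K, (fun u => (k u : N)) ∈ LinearMap.range r := by
    intro k
    choose n hn using fun u => (k u).2
    refine ⟨⟨Γ.convolution ρ e (ι n), ?_⟩, funext fun u => ?_⟩
    · refine funext fun v => ?_
      rw [hA, (hp v v.2).convolution_convolution_apply h1 ρ x e hxB heB, hxe, map_zero]
      rfl
    · exact (heval n u).trans (hn u)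
  let j : (V₁ → K) →ₗ[R] LinearMap.range r :=
    (LinearMap.pi fun u => K.subtype ∘ₗ LinearMap.proj u).codRestrict _ hmem
  have hj : Function.Injective j := fun k k' h => funext fun u =>
    Subtype.ext (congrFun (congrArg Subtype.val h) u)
  have hker : V₁.card * Module.relLength R E K ≤ Module.relLength R E (LinearMap.ker A) := by
    rw [← Fintype.card_coe V₁, ← Module.relLength_pi]
    exact (Module.relLength_le_of_injective hE j hj).trans
      (Module.relLength_le_of_surjective r.rangeRestrict r.surjective_rangeRestrict)
  have hrange : V₀.card * Module.relLength R E N ≤ Module.relLength R E (LinearMap.range A) := by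
    rw [← Fintype.card_coe V₀, ← Module.relLength_pi]
    exact Module.relLength_le_of_surjective (LinearMap.range A).subtype fun n =>
      ⟨⟨n, hsurj n⟩, rfl⟩
  rw [← Module.relLength_pi, Module.relLength_eq_ker_add_range hE A]
  exact add_le_add hker hrange

/-- If `x * y = 1` in the group ring of a finitely generated sofic group over a ring that acts on a
Noetherian module `N`, and `N` has no proper nonzero stable submodule, then `1 - y * x` acts
trivially. -/
theorem IsSoficFG.action_coeff_one_sub_mul_eq_zero_of_simple (hH : IsSoficFG H) [Group.FG H]
    [IsNoetherian R N] (ρ : S →+* Module.End R N)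
    (hρ : ∀ K : Submodule R N, (∀ s, K ≤ K.comap (ρ s)) → K = ⊥ ∨ K = ⊤)
    {x y : MonoidAlgebra S H} (hxy : x * y = 1) (g : H) : ρ ((1 - y * x).coeff g) = 0 := by
  classical
  by_contra hg
  let e := 1 - y * x
  have hxe : x * e = 0 := by
    rw [mul_sub, mul_one, ← mul_assoc, hxy, one_mul, sub_self]
  have : Nontrivial N := by
    by_contra hN
    rw [not_nontrivial_iff_subsingleton] at hN
    exact hg (Subsingleton.elim _ _)
  obtain ⟨E, _, _, hE, hfin, hpos⟩ := exists_relLength_ne_top ρ hρ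
  obtain ⟨l, hl⟩ := ENat.ne_top_iff_exists.1 hfin
  obtain ⟨F, hF⟩ := Group.fg_def.1 ‹Group.FG H›
  let F' : Finset H := insert 1 (F ∪ x.coeff.support ∪ y.coeff.support ∪ e.coeff.support)
  let B : Set H := ↑(F' ∪ F'.image (·⁻¹))
  have hB : B.Finite := Finset.finite_toSet _
  have hinv : ∀ b ∈ B, b⁻¹ ∈ B := by
    intro b hb
    simp only [B, Finset.mem_coe, Finset.mem_union, Finset.mem_image] at hb ⊢
    rcases hb with hb | ⟨c, hc, rfl⟩
    · exact Or.inr ⟨b, hb, rfl⟩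
    · exact Or.inl (by rwa [inv_inv])
  have hsub : ∀ h ∈ F', h ∈ B := fun h hh => Finset.mem_coe.2 (Finset.mem_union_left _ hh)
  have h1 : 1 ∈ B := hsub 1 (by simp [F'])
  have hgen : Subgroup.closure B = ⊤ :=
    top_le_iff.1 (hF.ge.trans (Subgroup.closure_mono fun h hh => hsub h (by
      simp [F', Finset.mem_coe.1 hh])))
  have hxB : ∀ h, x.coeff h ≠ 0 → h ∈ B := fun h hh => hsub h (by simp [F', hh])
  have hyB : ∀ h, y.coeff h ≠ 0 → h ∈ B := fun h hh => hsub h (by simp [F', hh])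
  have heB : ∀ h, e.coeff h ≠ 0 → h ∈ B := fun h hh => hsub h (by simp [F', hh])
  have hgB : g ∈ B := heB g fun h => hg (by
    change ρ (e.coeff g) = 0
    rw [h, map_zero])
  have : Fintype B := hB.fintype
  -- the proportion of bad vertices is so small that they cannot make up for the kernel of `x`
  obtain ⟨V, _, _, Γ, V₀, hcard, hchart⟩ := hH.exists_isChart hB h1 hinv hgen
    (ε := 1 / (2 + (B.ncard : ℝ) ^ 2 * l)) (by positivity) (by
      rw [div_lt_one (by positivity)]
      have : 0 ≤ (B.ncard : ℝ) ^ 2 * l := by positivity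
      linarith)
  choose! p hp using hchart
  obtain ⟨V₁, hV, hcard₁, hdisj⟩ := Γ.exists_disjoint_charts hB h1 hinv V₀ p hp
  have hlen := Γ.card_mul_relLength_le hE ρ h1 x y e hxB hyB heB hxy hxe V₀ V₁ hV p hp hdisj hgB
  have h2 : (V₁.card : ℕ∞) ≤
      V₁.card * Module.relLength R E (LinearMap.range (ρ (e.coeff g))) := by
    conv_lhs => rw [← mul_one (V₁.card : ℕ∞)]
    exact mul_le_mul_right (hpos _ fun h => hg (LinearMap.range_eq_bot.1 h)) _
  have h3 : V₁.card + V₀.card * l ≤ Fintype.card V * l := by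
    have := (add_le_add_left h2 _).trans hlen
    rw [← hl] at this
    exact_mod_cast this
  have h3' : (V₁.card : ℝ) + V₀.card * l ≤ Fintype.card V * l := by exact_mod_cast h3
  have h4 : (V₀.card : ℝ) ≤ V₁.card * (B.ncard : ℝ) ^ 2 := by exact_mod_cast hcard₁
  have hm : (0 : ℝ) < Fintype.card V := by exact_mod_cast Fintype.card_pos
  set m : ℝ := (Fintype.card V : ℝ)
  set q : ℝ := (B.ncard : ℝ) ^ 2
  have hq : 0 ≤ q := by positivity
  have hl0 : (0 : ℝ) ≤ l := by positivity
  set ε : ℝ := 1 / (2 + q * l)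
  have hε : ε * (2 + q * l) = 1 := by
    simp only [ε]
    rw [one_div, inv_mul_cancel₀ (by positivity)]
  have hε0 : 0 < ε := by positivity
  have h5 : (V₁.card : ℝ) * q ≤ (m - V₀.card) * l * q := by
    refine mul_le_mul_of_nonneg_right ?_ hq
    linarith
  have h6 : (m - V₀.card) * (l * q) ≤ ε * m * (l * q) :=
    mul_le_mul_of_nonneg_right (by linarith) (by positivity)
  have h7 : (1 - ε) * m ≤ ε * m * (l * q) := by linarith
  have h8 : ε * m * (l * q) = m - 2 * (ε * m) := by linear_combination m * hε
  have h9 : 0 < ε * m := by positivity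
  linarith

/-- The action on the quotient by a stable submodule. -/
def quotientAction (ρ : S →+* Module.End R N) (K : Submodule R N)
    (hK : ∀ s, K ≤ K.comap (ρ s)) : S →+* Module.End R (N ⧸ K) where
  toFun s := K.mapQ K (ρ s) (hK s)
  map_one' := by ext; simp
  map_mul' s t := by ext; simp
  map_zero' := by ext; simp
  map_add' s t := by ext; simp

/-- The action on a stable submodule. -/
def submoduleAction (ρ : S →+* Module.End R N) (K : Submodule R N)
    (hK : ∀ s, K ≤ K.comap (ρ s)) : S →+* Module.End R K where
  toFun s := (ρ s).restrict (hK s)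
  map_one' := by ext; simp
  map_mul' s t := by ext; simp
  map_zero' := by ext; simp
  map_add' s t := by ext; simp

/-- The reduction to the simple case: for a maximal stable `K` such that `e = 1 - y * x` acts
nontrivially on `N ⧸ K`, the stable submodule of `N ⧸ K` that is generated by the images of the
coefficients of `e` has no proper nonzero stable submodule, and `e` acts nontrivially on it because
`e` is idempotent. -/
theorem IsSoficFG.action_coeff_one_sub_mul_eq_zero (hH : IsSoficFG H) [Group.FG H]
    [IsNoetherian R N] (ρ : S →+* Module.End R N)
    {x y : MonoidAlgebra S H} (hxy : x * y = 1) (g : H) : ρ ((1 - y * x).coeff g) = 0 := by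
  classical
  by_contra hg
  set e := 1 - y * x with he
  have hee : e * e = e := by
    have : y * x * (y * x) = y * x := by
      rw [mul_assoc, ← mul_assoc x, hxy, one_mul]
    rw [he, mul_sub, mul_one, sub_mul, this, one_mul, sub_self, sub_zero]
  obtain ⟨K, ⟨hK, hKe⟩, hmax⟩ := set_has_maximal_iff_noetherian.2 ‹IsNoetherian R N›
    {K : Submodule R N | (∀ s, K ≤ K.comap (ρ s)) ∧ ¬ ∀ h n, ρ (e.coeff h) n ∈ K}
    ⟨⊥, fun s => bot_le, fun h => hg (LinearMap.ext fun n => by simpa using h g n)⟩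
  let σ := quotientAction ρ K hK
  have hσ : ∀ s n, σ s (K.mkQ n) = K.mkQ (ρ s n) := fun s n => rfl
  let K₀ : Submodule R (N ⧸ K) :=
    sInf {L | (∀ s, L ≤ L.comap (σ s)) ∧ ∀ h n, σ (e.coeff h) n ∈ L}
  have hK₀ : ∀ s, K₀ ≤ K₀.comap (σ s) := fun s n hn => by
    rw [Submodule.mem_comap, Submodule.mem_sInf]
    exact fun L hL => hL.1 s (Submodule.mem_sInf.1 hn L hL)
  have heK₀ : ∀ h n, σ (e.coeff h) n ∈ K₀ := fun h n =>
    Submodule.mem_sInf.2 fun L hL => hL.2 h n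
  have hsimple : ∀ L : Submodule R K₀, (∀ s, L ≤ L.comap (submoduleAction σ K₀ hK₀ s)) →
      L = ⊥ ∨ L = ⊤ := by
    intro L hL
    refine or_iff_not_imp_left.2 fun hL0 => ?_
    let L' := L.map K₀.subtype
    have hL' : ∀ s, L' ≤ L'.comap (σ s) := by
      rintro s _ ⟨n, hn, rfl⟩
      exact ⟨_, hL s hn, rfl⟩
    have hlt : K < L'.comap K.mkQ := by
      refine lt_of_le_of_ne (fun n hn => ?_) fun heq => hL0 ?_
      · rw [Submodule.mem_comap, Submodule.mkQ_apply, (Submodule.Quotient.mk_eq_zero K).2 hn]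
        exact zero_mem _
      · rw [Submodule.eq_bot_iff]
        intro n hn
        obtain ⟨n', hn'⟩ := K.mkQ_surjective n.1
        have : n' ∈ L'.comap K.mkQ := by
          rw [Submodule.mem_comap, hn']
          exact ⟨n, hn, rfl⟩
        rw [← heq] at this
        refine Subtype.ext ?_
        rw [← hn', Submodule.mkQ_apply, (Submodule.Quotient.mk_eq_zero K).2 this]
        rfl
    have hmem : ∀ h n, ρ (e.coeff h) n ∈ L'.comap K.mkQ := by
      by_contra hno
      exact hmax _ ⟨fun s n hn => hL' s hn, hno⟩ hlt
    have hle : K₀ ≤ L' := sInf_le ⟨hL', fun h n => by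
      obtain ⟨n, rfl⟩ := K.mkQ_surjective n
      exact hmem h n⟩
    rw [eq_top_iff]
    rintro ⟨n, hn⟩ -
    obtain ⟨n', hn', rfl⟩ := hle hn
    exact hn'
  have hzero :=
    hH.action_coeff_one_sub_mul_eq_zero_of_simple (submoduleAction σ K₀ hK₀) hsimple hxy
  refine hKe fun h n => ?_
  have hkill : ∀ h', ∀ n ∈ K₀, σ (e.coeff h') n = 0 := fun h' n hn =>
    congrArg Subtype.val (LinearMap.congr_fun (hzero h') ⟨n, hn⟩)
  have : σ (e.coeff h) (K.mkQ n) = 0 := by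
    conv_lhs => rw [← hee]
    rw [MonoidAlgebra.coeff_mul, Finsupp.sum, map_sum, LinearMap.sum_apply]
    refine Finset.sum_eq_zero fun b _ => ?_
    rw [Finsupp.sum, map_sum, LinearMap.sum_apply]
    refine Finset.sum_eq_zero fun c _ => ?_
    split_ifs
    · rw [map_mul, Module.End.mul_apply, hkill b _ (heK₀ c _)]
    · rw [map_zero, LinearMap.zero_apply]
  rwa [hσ, Submodule.mkQ_apply, Submodule.Quotient.mk_eq_zero] at this

end core

/-- For a ring `S` that acts faithfully on a Noetherian module and a sofic group `G`, the group ring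
`S[G]` is directly finite. Only a finitely generated subgroup of `G` matters for a given pair of
elements. -/
theorem IsSofic.isDedekindFiniteMonoid_monoidAlgebra {R N S G : Type*} [Ring R] [AddCommGroup N]
    [Module R N] [Ring S] [Group G] (hG : IsSofic G) [IsNoetherian R N]
    (ρ : S →+* Module.End R N) (hρ : Function.Injective ρ) :
    IsDedekindFiniteMonoid (MonoidAlgebra S G) := by
  classical
  refine ⟨fun {x y} hxy => ?_⟩
  let F : Finset G := x.coeff.support ∪ y.coeff.support
  let H : Subgroup G := Subgroup.closure F
  have hFG : H.FG := ⟨F, rfl⟩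
  have : Group.FG H := (Group.fg_iff_subgroup_fg H).2 hFG
  let f := MonoidAlgebra.mapDomainRingHom S H.subtype
  have hf : Function.Injective f := MonoidAlgebra.mapDomain_injective H.subtype_injective
  have hrange : ∀ z : MonoidAlgebra S G, z.coeff.support ⊆ F → ∃ z', f z' = z := by
    intro z hz
    refine ⟨.ofCoeff (z.coeff.comapDomain H.subtype H.subtype_injective.injOn), ?_⟩
    refine MonoidAlgebra.coeff_injective ?_
    refine Finsupp.mapDomain_comapDomain _ H.subtype_injective _ fun g hg => ?_
    exact ⟨⟨g, Subgroup.subset_closure (hz hg)⟩, rfl⟩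
  obtain ⟨x', hx'⟩ := hrange x Finset.subset_union_left
  obtain ⟨y', hy'⟩ := hrange y Finset.subset_union_right
  have hxy' : x' * y' = 1 := hf (by rw [map_mul, hx', hy', hxy, map_one])
  have h0 : 1 - y' * x' = 0 := by
    refine MonoidAlgebra.coeff_injective (Finsupp.ext fun g => hρ ?_)
    rw [(hG H hFG).action_coeff_one_sub_mul_eq_zero ρ hxy' g]
    simp
  rw [← hx', ← hy', ← map_mul, ← sub_eq_zero.1 h0, map_one]

/-! ### Matrices over group rings -/

/-- The group ring of a matrix ring, as a ring of matrices over the group ring. -/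
noncomputable def MonoidAlgebra.matrixRingHom (A G ι : Type*) [Ring A] [Group G] [Fintype ι]
    [DecidableEq ι] :
    MonoidAlgebra (Matrix ι ι A) G →+* Matrix ι ι (MonoidAlgebra A G) :=
  liftNCRingHom (singleOneRingHom (R := A) (M := G)).mapMatrix
    ((Matrix.scalar ι).toMonoidHom.comp (of A G))
    fun M g => by
      ext i j
      simp [Matrix.scalar_apply, Matrix.mul_diagonal, Matrix.diagonal_mul]

theorem MonoidAlgebra.coeff_matrixRingHom {A G ι : Type*} [Ring A] [Group G] [Fintype ι]
    [DecidableEq ι] (x : MonoidAlgebra (Matrix ι ι A) G) (i j : ι) (g : G) :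
    (matrixRingHom A G ι x i j).coeff g = x.coeff g i j := by
  induction x using MonoidAlgebra.induction_linear with
  | zero => simp
  | add x y hx hy => simp [hx, hy]
  | single h M =>
    classical
    rw [show matrixRingHom A G ι (single h M) = _ from liftNCRingHom_single _ _ _ h M]
    simp [Matrix.scalar_apply, Matrix.mul_diagonal, Finsupp.single_apply]
    split_ifs <;> simp

theorem MonoidAlgebra.matrixRingHom_bijective (A G ι : Type*) [Ring A] [Group G] [Fintype ι]
    [DecidableEq ι] : Function.Bijective (matrixRingHom A G ι) := by
  classical
  constructor
  · intro x y h
    refine coeff_injective (Finsupp.ext fun g => Matrix.ext fun i j => ?_)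
    rw [← coeff_matrixRingHom, h, coeff_matrixRingHom]
  · intro M
    refine ⟨.ofCoeff (Finsupp.onFinset
      (Finset.univ.biUnion fun i => Finset.univ.biUnion fun j => (M i j).coeff.support)
      (fun g i j => (M i j).coeff g) fun g hg => ?_), ?_⟩
    · by_contra h
      refine hg (Matrix.ext fun i j => ?_)
      simp only [Finset.mem_biUnion, Finset.mem_univ, true_and, not_exists,
        Finsupp.mem_support_iff, not_not] at h
      exact h i j
    · refine Matrix.ext fun i j => coeff_injective (Finsupp.ext fun g => ?_)
      rw [coeff_matrixRingHom]
      rfl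

/-- The group ring over `End_R(N)`, for a Noetherian `N`, is stably finite: the matrices over it
form the group ring of `End_R(N^k)`. -/
theorem IsSofic.isStablyFiniteRing_monoidAlgebra_end {R N G : Type*} [Ring R] [AddCommGroup N]
    [Module R N] [Group G] (hG : IsSofic G) [IsNoetherian R N] :
    IsStablyFiniteRing (MonoidAlgebra (Module.End R N) G) := by
  refine ⟨fun k => ?_⟩
  have := hG.isDedekindFiniteMonoid_monoidAlgebra
    (endVecRingEquivMatrixEnd (Fin k) R N).symm.toRingHom
    (endVecRingEquivMatrixEnd (Fin k) R N).symm.injective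
  exact .of_injective (RingEquiv.ofBijective _
    (MonoidAlgebra.matrixRingHom_bijective (Module.End R N) G (Fin k))).symm
    (RingEquiv.injective _)

/-! ### Endomorphisms of induced modules -/

namespace InducedModule

open scoped TensorProduct

variable {R G N : Type*} [Ring R] [Group G] [AddCommGroup N] [Module R N]

/-- The class of `s ⊗ n`. -/
noncomputable def mk (s : MonoidAlgebra R G) (n : N) : InducedModule R G N :=
  Submodule.Quotient.mk (s ⊗ₜ[ℤ] n)

theorem mk_add_left (s t : MonoidAlgebra R G) (n : N) : mk (s + t) n = mk s n + mk t n := by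
  simp only [mk, TensorProduct.add_tmul, Submodule.Quotient.mk_add]

theorem mk_add_right (s : MonoidAlgebra R G) (n n' : N) : mk s (n + n') = mk s n + mk s n' := by
  simp only [mk, TensorProduct.tmul_add, Submodule.Quotient.mk_add]

theorem mk_zero_left (n : N) : mk (0 : MonoidAlgebra R G) n = 0 := by simp [mk]

theorem mk_zero_right (s : MonoidAlgebra R G) : mk s (0 : N) = 0 := by simp [mk]

theorem smul_mk (s t : MonoidAlgebra R G) (n : N) : s • mk t n = mk (s * t) n := rfl

theorem mk_mul_single (s : MonoidAlgebra R G) (r : R) (n : N) :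
    mk (s * MonoidAlgebra.single 1 r) n = mk s (r • n) :=
  (Submodule.Quotient.eq _).2 (Submodule.subset_span ⟨s, r, n, rfl⟩)

theorem single_smul_mk_one (r : R) (n : N) :
    (MonoidAlgebra.single 1 r : MonoidAlgebra R G) • mk (1 : MonoidAlgebra R G) n =
      mk 1 (r • n) := by
  rw [smul_mk, mul_one, ← mk_mul_single, one_mul]

theorem induction_mk {p : InducedModule R G N → Prop} (t : InducedModule R G N)
    (mk : ∀ s n, p (mk s n)) (zero : p 0) (add : ∀ t t', p t → p t' → p (t + t')) : p t := by
  obtain ⟨t, rfl⟩ := Submodule.Quotient.mk_surjective _ t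
  induction t using TensorProduct.induction_on with
  | zero => exact zero
  | tmul s n => exact mk s n
  | add t t' ht ht' => exact add _ _ ht ht'

theorem hom_ext {Q : Type*} [AddCommGroup Q] [Module (MonoidAlgebra R G) Q]
    {f f' : InducedModule R G N →ₗ[MonoidAlgebra R G] Q} (h : ∀ n, f (mk 1 n) = f' (mk 1 n)) :
    f = f' := by
  refine LinearMap.ext fun t => ?_
  induction t using induction_mk with
  | mk s n => rw [← mul_one s, ← smul_mk, map_smul, map_smul, h]
  | zero => rw [map_zero, map_zero]
  | add t t' ht ht' => rw [map_add, map_add, ht, ht']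

/-- An additive map on `(R[G]) ⊗_R N`, given by a map that is biadditive and balanced over `R`. -/
noncomputable def liftAddHom {Q : Type*} [AddCommGroup Q] (u : MonoidAlgebra R G →+ N →+ Q)
    (hu : ∀ s r n, u (s * MonoidAlgebra.single 1 r) n = u s (r • n)) :
    InducedModule R G N →+ Q :=
  QuotientAddGroup.lift _
    (TensorProduct.liftAddHom u fun k s n => by simp [-zsmul_eq_mul]) fun t ht => by
      -- the generating set of the relations is stable under `R[G]`
      suffices h : ∀ a : MonoidAlgebra R G,
          TensorProduct.liftAddHom u (fun (k : ℤ) s n => by simp [-zsmul_eq_mul]) (a • t) = 0 by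
        simpa using h 1
      replace ht : t ∈ Submodule.span _ _ := ht
      induction ht using Submodule.span_induction with
      | mem t h =>
        obtain ⟨s, r, n, rfl⟩ := h
        intro a
        rw [smul_sub, map_sub, TensorProduct.smul_tmul', TensorProduct.smul_tmul', smul_eq_mul,
          smul_eq_mul, ← mul_assoc]
        simp only [TensorProduct.liftAddHom_tmul]
        exact sub_eq_zero.2 (hu _ _ _)
      | zero => simp
      | add t t' _ _ h h' => intro a; rw [smul_add, map_add, h, h', add_zero]
      | smul b t _ h => intro a; rw [smul_smul, h]

/-- The universal property of the induced module. -/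
noncomputable def lift {Q : Type*} [AddCommGroup Q] [Module (MonoidAlgebra R G) Q] (u : N →+ Q)
    (hu : ∀ (r : R) n, u (r • n) = (MonoidAlgebra.single 1 r : MonoidAlgebra R G) • u n) :
    InducedModule R G N →ₗ[MonoidAlgebra R G] Q :=
  let f := liftAddHom (R := R) (G := G)
    { toFun := fun s => (DistribSMul.toAddMonoidHom Q s).comp u
      map_zero' := by ext; simp
      map_add' := fun s t => by ext; simp [add_smul] }
    fun s r n => by simp [hu, mul_smul]
  { f with
    map_smul' := fun s t => by
      change f (s • t) = s • f t
      induction t using induction_mk with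
      | mk t n => exact mul_smul s t (u n)
      | zero => simp
      | add t t' ht ht' => rw [smul_add, map_add, map_add, smul_add, ht, ht'] }

theorem lift_mk {Q : Type*} [AddCommGroup Q] [Module (MonoidAlgebra R G) Q] (u : N →+ Q)
    (hu : ∀ (r : R) n, u (r • n) = (MonoidAlgebra.single 1 r : MonoidAlgebra R G) • u n)
    (s : MonoidAlgebra R G) (n : N) : lift u hu (mk s n) = s • u n := rfl

/-- The coefficient at `g` of an element of `R[G] ⊗_R N`, which is a direct sum of copies of `N`
indexed by `G`. -/
noncomputable def coeff (g : G) : InducedModule R G N →+ N :=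
  liftAddHom
    { toFun := fun s => DistribSMul.toAddMonoidHom N (s.coeff g)
      map_zero' := by ext; simp
      map_add' := fun s t => by ext; simp [add_smul] }
    fun s r n => by simp [mul_smul]

theorem coeff_mk (g : G) (s : MonoidAlgebra R G) (n : N) : coeff g (mk s n) = s.coeff g • n := rfl

theorem coeff_single_one_smul (g : G) (r : R) (t : InducedModule R G N) :
    coeff g ((MonoidAlgebra.single 1 r : MonoidAlgebra R G) • t) = r • coeff g t := by
  induction t using induction_mk with
  | mk s n => rw [smul_mk, coeff_mk, coeff_mk, MonoidAlgebra.coeff_single_one_mul, mul_smul]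
  | zero => simp
  | add t t' ht ht' => rw [smul_add, map_add, map_add, ht, ht', smul_add]

theorem exists_eq_sum (t : InducedModule R G N) :
    ∃ n : G →₀ N, t = n.sum fun g m => mk (MonoidAlgebra.single g 1) m := by
  classical
  induction t using induction_mk with
  | mk s n =>
    induction s using MonoidAlgebra.induction_linear with
    | zero => exact ⟨0, by simp [mk_zero_left]⟩
    | add s s' hs hs' =>
      obtain ⟨m, hm⟩ := hs
      obtain ⟨m', hm'⟩ := hs'
      exact ⟨m + m', by
        rw [mk_add_left, hm, hm', Finsupp.sum_add_index' (fun _ => mk_zero_right _)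
          fun _ _ _ => mk_add_right _ _ _]⟩
    | single g r =>
      refine ⟨Finsupp.single g (r • n), ?_⟩
      rw [Finsupp.sum_single_index
        (h := fun g m => mk (MonoidAlgebra.single g (1 : R)) m) (mk_zero_right _), ← mk_mul_single,
        MonoidAlgebra.single_mul_single, mul_one, one_mul]
  | zero => exact ⟨0, by simp⟩
  | add t t' ht ht' =>
    obtain ⟨m, hm⟩ := ht
    obtain ⟨m', hm'⟩ := ht'
    exact ⟨m + m', by
      rw [hm, hm', Finsupp.sum_add_index' (fun _ => mk_zero_right _)
        fun _ _ _ => mk_add_right _ _ _]⟩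

theorem coeff_sum (n : G →₀ N) (h : G) :
    coeff h (n.sum fun g m => mk (MonoidAlgebra.single g (1 : R)) m) = n h := by
  classical
  rw [Finsupp.sum, map_sum]
  simp only [coeff_mk, MonoidAlgebra.coeff_single, Finsupp.single_apply, ite_smul, one_smul,
    zero_smul]
  rw [Finset.sum_ite_eq' n.support h]
  simp +contextual [eq_comm]

theorem ext_coeff {t t' : InducedModule R G N} (h : ∀ g, coeff g t = coeff g t') : t = t' := by
  obtain ⟨n, rfl⟩ := exists_eq_sum t
  obtain ⟨n', rfl⟩ := exists_eq_sum t'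
  have : n = n' := Finsupp.ext fun g => by simpa only [coeff_sum] using h g
  rw [this]

theorem finite_coeff_ne_zero (t : InducedModule R G N) : {g | coeff g t ≠ 0}.Finite := by
  obtain ⟨n, rfl⟩ := exists_eq_sum t
  simp only [coeff_sum]
  exact n.hasFiniteSupport

/-- The action of `End_R(N)` on `R[G] ⊗_R N` through the right factor. -/
noncomputable def endAction :
    Module.End R N →+* Module.End (MonoidAlgebra R G) (InducedModule R G N) where
  toFun a := lift
    { toFun := fun n => mk 1 (a n)
      map_zero' := by rw [map_zero, mk_zero_right]
      map_add' := fun n n' => by rw [map_add, mk_add_right] }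
    fun r n => by simp [single_smul_mk_one]
  map_one' := hom_ext fun n => by simp [lift_mk]
  map_mul' a b := hom_ext fun n => by simp [lift_mk]
  map_zero' := hom_ext fun n => by simp [lift_mk, mk_zero_right]
  map_add' a b := hom_ext fun n => by simp [lift_mk, mk_add_right]

theorem endAction_mk (a : Module.End R N) (s : MonoidAlgebra R G) (n : N) :
    endAction a (mk s n) = mk s (a n) := by
  change s • mk (1 : MonoidAlgebra R G) (a n) = _
  rw [smul_mk, mul_one]

/-- The action of `G` on `R[G] ⊗_R N` by right multiplication with inverses on the left factor. -/
noncomputable def translationAction :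
    G →* Module.End (MonoidAlgebra R G) (InducedModule R G N) where
  toFun g := lift
    { toFun := fun n => mk (MonoidAlgebra.single g⁻¹ 1) n
      map_zero' := mk_zero_right _
      map_add' := mk_add_right _ }
    fun r n => by simp [smul_mk, ← mk_mul_single, MonoidAlgebra.single_mul_single]
  map_one' := hom_ext fun n => by simp [lift_mk, ← MonoidAlgebra.one_def]
  map_mul' g h := hom_ext fun n => by
    simp [lift_mk, smul_mk, MonoidAlgebra.single_mul_single]

theorem translationAction_mk (g : G) (s : MonoidAlgebra R G) (n : N) :
    translationAction g (mk s n) = mk (s * MonoidAlgebra.single g⁻¹ 1) n := rfl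

variable (R G N) in
/-- The action of `End_R(N)[G]` on `R[G] ⊗_R N` that combines `endAction` and
`translationAction`. -/
noncomputable def endRingHom :
    MonoidAlgebra (Module.End R N) G →+* Module.End (MonoidAlgebra R G) (InducedModule R G N) :=
  MonoidAlgebra.liftNCRingHom endAction translationAction fun a g => hom_ext fun n => by
    rw [Module.End.mul_apply, Module.End.mul_apply, translationAction_mk, endAction_mk,
      endAction_mk, translationAction_mk]

theorem coeff_endRingHom_mk_one (x : MonoidAlgebra (Module.End R N) G) (n : N) (g : G) :
    coeff g (endRingHom R G N x (mk 1 n)) = x.coeff g⁻¹ n := by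
  classical
  induction x using MonoidAlgebra.induction_linear with
  | zero => simp
  | add x y hx hy =>
    rw [map_add, LinearMap.add_apply, map_add, hx, hy]
    rfl
  | single h a =>
    rw [show endRingHom R G N (.single h a) = _ from
      MonoidAlgebra.liftNCRingHom_single _ _ _ h a, Module.End.mul_apply,
      translationAction_mk, endAction_mk, one_mul, coeff_mk, MonoidAlgebra.coeff_single,
      MonoidAlgebra.coeff_single, Finsupp.single_apply, Finsupp.single_apply]
    simp only [inv_eq_iff_eq_inv]
    split_ifs <;> simp

/-- An endomorphism is determined by the coefficients of its values on `N`. These are endomorphisms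
of `N`, and all but finitely many of them vanish on a finite generating set of `N`. -/
theorem endRingHom_bijective [Module.Finite R N] : Function.Bijective (endRingHom R G N) := by
  classical
  constructor
  · intro x y h
    refine MonoidAlgebra.coeff_injective (Finsupp.ext fun g => LinearMap.ext fun n => ?_)
    rw [← inv_inv g, ← coeff_endRingHom_mk_one, h, coeff_endRingHom_mk_one]
  · intro φ
    let a : G → Module.End R N := fun g =>
      { toFun := fun n => coeff g⁻¹ (φ (mk 1 n))
        map_add' := fun n n' => by rw [mk_add_right, map_add, map_add]
        map_smul' := fun r n => by
          rw [← single_smul_mk_one, map_smul, coeff_single_one_smul, RingHom.id_apply] }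
    obtain ⟨T, hT⟩ := Module.Finite.fg_top (R := R) (M := N)
    have hfin : (Function.support a).Finite := by
      refine (T.finite_toSet.biUnion fun n _ =>
        (finite_coeff_ne_zero (φ (mk 1 n))).image (·⁻¹)).subset fun g hg => ?_
      by_contra h
      refine hg (LinearMap.ext_on hT fun n hn => ?_)
      by_contra hne
      exact h (Set.mem_biUnion hn ⟨g⁻¹, hne, inv_inv g⟩)
    refine ⟨.ofCoeff (Finsupp.ofSupportFinite a hfin), hom_ext fun n => ext_coeff fun g => ?_⟩
    rw [coeff_endRingHom_mk_one]
    change coeff g⁻¹⁻¹ _ = _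
    rw [inv_inv]

variable (R G) in
/-- The isomorphism `R[G] ⊗_R R ≃ R[G]`. -/
noncomputable def equivSelf :
    InducedModule R G R ≃ₗ[MonoidAlgebra R G] MonoidAlgebra R G :=
  LinearEquiv.ofLinearMap
    (lift (MonoidAlgebra.singleOneRingHom : R →+* MonoidAlgebra R G).toAddMonoidHom
      fun r n => by simp [MonoidAlgebra.single_mul_single])
    (LinearMap.toSpanSingleton _ _ (mk 1 1))
    (LinearMap.ext_ring (by simp [lift_mk, MonoidAlgebra.one_def]))
    (hom_ext fun r => by simp [lift_mk, single_smul_mk_one])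

end InducedModule

/-! ### Stable finiteness of the endomorphism ring -/

theorem IsSofic.isStablyFiniteRing_end_inducedModule {R G N : Type*} [Ring R] [Group G]
    (hG : IsSofic G) [AddCommGroup N] [Module R N] [IsNoetherian R N] :
    IsStablyFiniteRing (Module.End (MonoidAlgebra R G) (InducedModule R G N)) := by
  have := hG.isStablyFiniteRing_monoidAlgebra_end (R := R) (N := N)
  exact .of_injective
    (RingEquiv.ofBijective _ (InducedModule.endRingHom_bijective (R := R) (G := G) (N := N))).symm
    (RingEquiv.injective _)

theorem mainTheorem1 (R : Type*) [Ring R] (G : Type*) [Group G] (hG : IsSofic G) :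
    (∀ (N : Type*) [AddCommGroup N] [Module R N], IsNoetherian R N →
      IsStablyFiniteRing (Module.End (MonoidAlgebra R G) (InducedModule R G N))) ∧
    (IsNoetherianRing R →
      Nonempty (MonoidAlgebra R G ≃+*
        (Module.End (MonoidAlgebra R G) (InducedModule R G R))ᵐᵒᵖ) ∧
      IsStablyFiniteRing (MonoidAlgebra R G)) := by
  refine ⟨fun N _ _ hN => hG.isStablyFiniteRing_end_inducedModule, fun hR => ?_⟩
  -- the endomorphisms of the free module of rank one are the right multiplications
  let e : MonoidAlgebra R G ≃+*
      (Module.End (MonoidAlgebra R G) (InducedModule R G R))ᵐᵒᵖ :=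
    (RingEquiv.opOp (MonoidAlgebra R G)).trans (RingEquiv.op
      ((RingEquiv.moduleEndSelf (MonoidAlgebra R G)).trans
        (InducedModule.equivSelf R G).symm.conjRingEquiv))
  have := hG.isStablyFiniteRing_end_inducedModule (R := R) (N := R)
  exact ⟨⟨e⟩, .of_injective e e.injective⟩
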